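/- Let $L_x, L_y, L_{x,y}\ge 0$ and $\sigma_x,\sigma_y>0$ satisfy $L_{x,y}\le\min(\sigma_x,\sigma_y)$. There is a constant $c$, depending only on $L_x, L_y, L_{x,y}, \sigma_x, \sigma_y$, such that the following holds for every $d$, every pair of norms $\|\cdot\|_x$, $\|\cdot\|_y$ on $\mathbb{R}^d$, all convex compact sets $\mathcal X,\mathcal Y\subset\mathbb{R}^d$, every probability distribution $P$ of $\xi$, and every function $F(x,y,\xi)$ that is $P$-integrable in $\xi$ for each $(x,y)\in\mathcal X\times\mathcal Y$. Assume that for $P$-almost every $\xi$, for all $x,x'\in\mathcal X$ and $y,y'\in\mathcal Y$: (i) $F(\cdot,y,\xi)$ is $\sigma_x$-strongly convex on $\mathcal X$ with respect to $\|\cdot\|_x$ and $F(x,\cdot,\xi)$ is $\sigma_y$-strongly concave on $\mathcal Y$ with respect to $\|\cdot\|_y$, i.e. for all $\alpha\in[0,1]$, $$F(\alpha x+(1-\alpha)x',y,\xi)\le \alpha F(x,y,\xi)+(1-\alpha)F(x',y,\xi)-\tfrac{\sigma_x\alpha(1-\alpha)}{2}\|x-x'\|_x^2,$$ $$F(x,\alpha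 y+(1-\alpha)y',\xi)\ge \alpha F(x,y,\xi)+(1-\alpha)F(x,y',\xi)+\tfrac{\sigma_y\alpha(1-\alpha)}{2}\|y-y'\|_y^2;$$ (ii) $|F(x,y,\xi)-F(x',y,\xi)|\le L_x\|x-x'\|_x$ and $|F(x,y,\xi)-F(x,y',\xi)|\le L_y\|y-y'\|_y$; (iii) $F$ has partial gradients $\nabla_xF(x,y,\xi)$ and $\nabla_yF(x,y,\xi)$ (derivatives relative to $\mathcal X$ and $\mathcal Y$) with $$\|\nabla_xF(x,y,\xi)-\nabla_xF(x,y',\xi)\|_{*x}\le L_{x,y}\|y-y'\|_y,\qquad \|\nabla_yF(x,y,\xi)-\nabla_yF(x',y,\xi)\|_{*y}\le L_{x,y}\|x-x'\|_x,$$ where $\|\cdot\|_{*x},\|\cdot\|_{*y}$ are the norms dual to $\|\cdot\|_x,\|\cdot\|_y$. Put $F(x,y)=\mathbb E_{\xi\sim P}F(x,y,\xi)$ and let $x^*(y)\in\arg\min_{x\in\mathcal X}F(x,y)$, $y^*(x)\in\arg\max_{y\in\mathcal Y}F(x,y)$. Then for every $n\ge 1$ and every $\delta\in(0,1)$, if $\xi_1,\dots,\xi_n$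 are drawn independently from $P$, with probability at least $1-\delta$ every saddle point $(\hat x,\hat y)\in\mathcal X\times\mathcal Y$ of the empirical problem $\min_{x\in\mathcal X}\max_{y\in\mathcal Y}\frac1n\sum_{i=1}^nF(x,y,\xi_i)$ satisfies $$F(\hat x,y^*(\hat x))-F(x^*(\hat y),\hat y)\le c\,\frac{d+\log(1/\delta)}{n}.$$ -/

import Mathlib

open MeasureTheory

/-- The population objective `F(x, y) = 𝐏 F(x, y, ξ)`, the expectation over `ξ ∼ P`. -/
noncomputable def popObjective {EX EY Ξ : Type*} [MeasurableSpace Ξ]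
    (P : Measure Ξ) (F : EX → EY → Ξ → ℝ) (x : EX) (y : EY) : ℝ :=
  ∫ ξ, F x y ξ ∂P

/-- The empirical objective `F̂(x, y) = (1 / n) ∑ i, F(x, y, ξ i)` of a sample `S = (ξ i)`. -/
noncomputable def empObjective {EX EY Ξ : Type*} {n : ℕ}
    (F : EX → EY → Ξ → ℝ) (S : Fin n → Ξ) (x : EX) (y : EY) : ℝ :=
  (1 / (n : ℝ)) * ∑ i, F x y (S i)

/-- `(x, y)` is a saddle point in `X × Y` of `G` (minimised in `x`, maximised in `y`), i.e. a
solution in `X × Y` of `min_{x ∈ X} max_{y ∈ Y} G x y`. -/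
def IsSaddleSolution {EX EY : Type*} (X : Set EX) (Y : Set EY) (G : EX → EY → ℝ)
    (x : EX) (y : EY) : Prop :=
  x ∈ X ∧ y ∈ Y ∧ IsSaddlePointOn X Y G x y

/-- `xs y` is a minimiser of `G(·, y)` over `X`, for every `y ∈ Y`. -/
def IsArgminMap {EX EY : Type*} (X : Set EX) (Y : Set EY) (G : EX → EY → ℝ)
    (xs : EY → EX) : Prop :=
  ∀ y ∈ Y, xs y ∈ X ∧ IsMinOn (fun x => G x y) X (xs y)

/-- `ys x` is a maximiser of `G(x, ·)` over `Y`, for every `x ∈ X`. -/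
def IsArgmaxMap {EX EY : Type*} (X : Set EX) (Y : Set EY) (G : EX → EY → ℝ)
    (ys : EX → EY) : Prop :=
  ∀ x ∈ X, ys x ∈ Y ∧ IsMaxOn (fun y => G x y) Y (ys x)

/-- The strong excess risk `G(x, ys x) - G(xs y, y)`. -/
def strongExcessRisk {EX EY : Type*} (G : EX → EY → ℝ) (xs : EY → EX) (ys : EX → EY)
    (x : EX) (y : EY) : ℝ :=
  G x (ys x) - G (xs y) y

section Assumptions

variable {EX EY : Type*} [NormedAddCommGroup EX] [NormedSpace ℝ EX]
  [NormedAddCommGroup EY] [NormedSpace ℝ EY]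

/-- `f(·, y)` is `σx`-strongly convex on `X` and `f(x, ·)` is `σy`-strongly concave on `Y`. -/
def StronglyConvexConcave (X : Set EX) (Y : Set EY) (σx σy : ℝ) (f : EX → EY → ℝ) : Prop :=
  (∀ y ∈ Y, StrongConvexOn X σx (fun x => f x y)) ∧
    (∀ x ∈ X, StrongConcaveOn Y σy (fun y => f x y))

/-- `f(·, y)` is `Lx`-Lipschitz on `X` and `f(x, ·)` is `Ly`-Lipschitz on `Y`. -/
def SeparatelyLipschitz (X : Set EX) (Y : Set EY) (Lx Ly : ℝ) (f : EX → EY → ℝ) : Prop :=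
  (∀ x ∈ X, ∀ x' ∈ X, ∀ y ∈ Y, |f x y - f x' y| ≤ Lx * ‖x - x'‖) ∧
    (∀ x ∈ X, ∀ y ∈ Y, ∀ y' ∈ Y, |f x y - f x y'| ≤ Ly * ‖y - y'‖)

/-- `f` has partial gradients `∇ₓ f(x, y)` and `∇ᵧ f(x, y)` on `X × Y`, with `∇ₓ f(x, ·)` and
`∇ᵧ f(·, y)` both `Lxy`-Lipschitz. Gradients are continuous linear functionals and their norm is
the operator norm, that is, the dual norm. Differentiability is only asked relative to `X` and
`Y`, since `f` matters only there and these sets may have empty interior. -/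
def LipschitzCrossGradient (X : Set EX) (Y : Set EY) (Lxy : ℝ) (f : EX → EY → ℝ) : Prop :=
  ∃ (gx : EX → EY → (EX →L[ℝ] ℝ)) (gy : EX → EY → (EY →L[ℝ] ℝ)),
    (∀ x ∈ X, ∀ y ∈ Y, HasFDerivWithinAt (fun u => f u y) (gx x y) X x) ∧
    (∀ x ∈ X, ∀ y ∈ Y, HasFDerivWithinAt (fun v => f x v) (gy x y) Y y) ∧
    (∀ x ∈ X, ∀ y ∈ Y, ∀ y' ∈ Y, ‖gx x y - gx x y'‖ ≤ Lxy * ‖y - y'‖) ∧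
    (∀ x ∈ X, ∀ x' ∈ X, ∀ y ∈ Y, ‖gy x y - gy x' y‖ ≤ Lxy * ‖x - x'‖)

end Assumptions

/-!
Write `P` for the expectation, `Pₙ` for the empirical mean, `(x̂, ŷ)` for an empirical saddle point
and `(x₀, y₀)` for a saddle point of the population objective, which exists by Sion's theorem.
The strong excess risk `R` at `(x̂, ŷ)` is `P F(x̂, ys x̂) - P F(xs ŷ, ŷ)`, and the empirical saddle
inequality `Pₙ F(x̂, ys x̂) ≤ Pₙ F(xs ŷ, ŷ)` gives `R ≤ |D z₁ - D z₀| + |D z₂ - D z₀|`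
(`strongExcessRisk_le_empDeviation`), where `D z = (P - Pₙ) F(z)`, `z₁ = (x̂, ys x̂)`,
`z₂ = (xs ŷ, ŷ)` and `z₀ = (x₀, y₀)`. On the other hand, strong convexity-concavity of the population
objective makes `R` at least a multiple of `‖z₁ - z₀‖² + ‖z₂ - z₀‖²`
(`mul_sq_norm_le_strongExcessRisk`).

It remains to control `D` uniformly on `X × Y` with a localised bound: with probability at least
`1 - δ`, for all `z`, `|D z - D z₀| ≤ ε ‖z - z₀‖² + C (dim + log (1 / δ)) / n`, with `C` depending only
on `ε` and the Lipschitz constant (`measure_pi_exists_deviation_le`). A small `ε` lets the quadratic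
terms be absorbed by `R / 2`, and the rate follows. The localised bound is obtained by chaining
Hoeffding's inequality along dyadic nets of a ball around `z₀`
(`measure_pi_exists_deviation_ball_le`), which avoids a factor `log n`, and then by peeling over balls
of geometrically growing radii.

Only deviations at the points of finite nets are measured, and the Lipschitz property extends the
bounds to all points; no measurability of suprema is needed, as the bad events are bounded in outer
measure.
-/

/-! ### Finite nets in normed spaces -/

/-- Volume bound: an `ε`-separated subset of a ball of radius `r` has at most
`((r + ε / 2) / (ε / 2)) ^ dim` points. -/
theorem card_mul_pow_le_of_separated {E : Type*} [NormedAddCommGroup E] [NormedSpace ℝ E]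
    [FiniteDimensional ℝ E] {z₀ : E} {r ε : ℝ} (hr : 0 ≤ r) (hε : 0 < ε) (N : Finset E)
    (hN : ∀ u ∈ N, ‖u - z₀‖ ≤ r) (hsep : ∀ u ∈ N, ∀ v ∈ N, u ≠ v → ε ≤ ‖u - v‖) :
    (N.card : ℝ) * (ε / 2) ^ Module.finrank ℝ E ≤ (r + ε / 2) ^ Module.finrank ℝ E := by
  borelize E
  let μ : Measure E := Measure.addHaar
  have hε2 : 0 < ε / 2 := by positivity
  have hρ : 0 < r + ε / 2 := by positivity
  have hD : Set.Pairwise (N : Set E) (Function.onFun Disjoint fun c => Metric.ball c (ε / 2)) := by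
    intro c hc d hd hcd
    apply Metric.ball_disjoint_ball
    rw [dist_eq_norm]
    linarith [hsep c hc d hd hcd]
  have hsub : (⋃ c ∈ N, Metric.ball c (ε / 2)) ⊆ Metric.ball z₀ (r + ε / 2) := by
    refine Set.iUnion₂_subset fun x hx => Metric.ball_subset_ball' ?_
    rw [dist_eq_norm]
    linarith [hN x hx]
  have hvol : (N.card : ENNReal) * ENNReal.ofReal ((ε / 2) ^ Module.finrank ℝ E)
        * μ (Metric.ball 0 1) ≤
      ENNReal.ofReal ((r + ε / 2) ^ Module.finrank ℝ E) * μ (Metric.ball 0 1) := by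
    have h := measure_mono (μ := μ) hsub
    rw [measure_biUnion_finset hD fun c _ => measurableSet_ball] at h
    simpa only [μ.addHaar_ball_of_pos _ hε2, μ.addHaar_ball_of_pos _ hρ, Finset.sum_const,
      nsmul_eq_mul, mul_assoc] using h
  have h := (ENNReal.mul_le_mul_iff_left
    (Metric.measure_ball_pos μ _ zero_lt_one).ne' measure_ball_lt_top.ne).1 hvol
  have h' := ENNReal.toReal_le_of_le_ofReal (by positivity) h
  rwa [ENNReal.toReal_mul, ENNReal.toReal_natCast, ENNReal.toReal_ofReal (by positivity)] at h'

/-- A subset `B` of a ball of radius `r` has, for every `k`, an internal `r / 2 ^ k`-net with at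
most `2 ^ ((k + 2) * dim)` points: a separated family of maximal cardinality is a net. -/
theorem exists_finset_net {E : Type*} [NormedAddCommGroup E] [NormedSpace ℝ E]
    [FiniteDimensional ℝ E] {B : Set E} {z₀ : E} {r : ℝ} (hr : 0 < r)
    (hB : ∀ z ∈ B, ‖z - z₀‖ ≤ r) (k : ℕ) :
    ∃ N : Finset E, (∀ u ∈ N, u ∈ B) ∧ (∀ z ∈ B, ∃ u ∈ N, ‖z - u‖ ≤ r / 2 ^ k) ∧
      N.card ≤ 2 ^ ((k + 2) * Module.finrank ℝ E) := by
  classical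
  set m := Module.finrank ℝ E
  set ε : ℝ := r / 2 ^ k with hεdef
  have hε : 0 < ε := by positivity
  have hcard : ∀ N : Finset E, (∀ u ∈ N, u ∈ B) → (∀ u ∈ N, ∀ v ∈ N, u ≠ v → ε ≤ ‖u - v‖) →
      N.card ≤ 2 ^ ((k + 2) * m) := by
    intro N hNB hsep
    have h := card_mul_pow_le_of_separated hr.le hε N (fun u hu => hB u (hNB u hu)) hsep
    have h1 : r + ε / 2 ≤ 2 ^ (k + 2) * (ε / 2) := by
      have h2 : r = 2 ^ k * ε := by rw [hεdef]; field_simp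
      have h3 : (1 : ℝ) ≤ 2 ^ k := one_le_pow₀ (by norm_num)
      rw [pow_add]
      nlinarith
    have h4 : (r + ε / 2) ^ m ≤ (2 : ℝ) ^ ((k + 2) * m) * (ε / 2) ^ m := by
      rw [pow_mul, ← mul_pow]
      exact pow_le_pow_left₀ (by positivity) h1 _
    have h5 : (N.card : ℝ) ≤ 2 ^ ((k + 2) * m) :=
      le_of_mul_le_mul_right (h.trans h4) (by positivity)
    exact_mod_cast h5
  set A : Set ℕ := {c | ∃ N : Finset E, (∀ u ∈ N, u ∈ B) ∧
    (∀ u ∈ N, ∀ v ∈ N, u ≠ v → ε ≤ ‖u - v‖) ∧ N.card = c}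
  have hA : BddAbove A := by
    refine ⟨2 ^ ((k + 2) * m), ?_⟩
    rintro c ⟨N, h1, h2, rfl⟩
    exact hcard N h1 h2
  obtain ⟨N, hNB, hsep, hc⟩ := Nat.sSup_mem (s := A) ⟨0, ∅, by simp, by simp, by simp⟩ hA
  refine ⟨N, hNB, fun z hz => ?_, hcard N hNB hsep⟩
  by_contra! hfar
  have hzN : z ∉ N := fun hzN => by
    have := hfar z hzN
    simp only [sub_self, norm_zero] at this
    linarith
  have hmem : (insert z N).card ∈ A := by
    refine ⟨insert z N, ?_, ?_, rfl⟩
    · intro u hu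
      rcases Finset.mem_insert.1 hu with rfl | hu
      exacts [hz, hNB u hu]
    · intro u hu v hv huv
      rcases Finset.mem_insert.1 hu with hu' | hu' <;>
        rcases Finset.mem_insert.1 hv with hv' | hv'
      · exact absurd (hu'.trans hv'.symm) huv
      · exact hu' ▸ (hfar v hv').le
      · rw [norm_sub_rev]; exact hv' ▸ (hfar u hu').le
      · exact hsep u hu' v hv' huv
  have := le_csSup hA hmem
  rw [Finset.card_insert_of_notMem hzN, hc] at this
  omega

/-! ### Chaining along dyadic nets -/

/-- Deterministic chaining: if the increments of `D` between consecutive dyadic nets of `B` are at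
most `τ (k + 1) / 2 ^ k` at level `k`, then `D` deviates by at most `4 τ = τ ∑ (k + 1) / 2 ^ k`
on `B`. The Lipschitz constant `K` only serves to pass to the limit and does not enter the bound. -/
theorem abs_sub_le_of_dyadic_increments {E : Type*} [NormedAddCommGroup E] {B : Set E} {z₀ : E}
    {r K τ : ℝ} (hr : 0 ≤ r) (hτ : 0 ≤ τ) (D : E → ℝ) (N : ℕ → Finset E) (hN0 : N 0 = {z₀})
    (hNB : ∀ k, ∀ u ∈ N k, u ∈ B) (hnet : ∀ k, ∀ z ∈ B, ∃ u ∈ N k, ‖z - u‖ ≤ r / 2 ^ k)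
    (hK : 0 ≤ K) (hLip : ∀ u ∈ B, ∀ v ∈ B, |D u - D v| ≤ K * ‖u - v‖)
    (hinc : ∀ k, ∀ u ∈ N k, ∀ v ∈ N (k + 1), ‖u - v‖ ≤ 2 * r / 2 ^ k →
      |D u - D v| ≤ τ * ((k + 1) / 2 ^ k))
    {z : E} (hz : z ∈ B) : |D z - D z₀| ≤ 4 * τ := by
  choose π hπN hπ using fun k => hnet k z hz
  have hπ0 : π 0 = z₀ := by simpa [hN0] using hπN 0
  have hstep : ∀ k, |D (π k) - D (π (k + 1))| ≤ τ * ((k + 1) / 2 ^ k) := by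
    intro k
    refine hinc k _ (hπN k) _ (hπN (k + 1)) ?_
    calc ‖π k - π (k + 1)‖ = ‖(z - π (k + 1)) - (z - π k)‖ := by congr 1; abel
      _ ≤ ‖z - π (k + 1)‖ + ‖z - π k‖ := norm_sub_le _ _
      _ ≤ r / 2 ^ (k + 1) + r / 2 ^ k := add_le_add (hπ _) (hπ _)
      _ ≤ r / 2 ^ k + r / 2 ^ k := by gcongr <;> simp
      _ = 2 * r / 2 ^ k := by ring
  have hsum : ∀ k : ℕ, |D (π k) - D z₀| ≤ τ * (4 - (2 * k + 4) / 2 ^ k) := by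
    intro k
    induction k with
    | zero => simp [hπ0]
    | succ k ih =>
      have h1 : |D (π (k + 1)) - D z₀| ≤ |D (π k) - D (π (k + 1))| + |D (π k) - D z₀| := by
        rw [abs_sub_comm (D (π k)) (D (π (k + 1)))]
        exact abs_sub_le _ _ _
      refine h1.trans ((add_le_add (hstep k) ih).trans (le_of_eq ?_))
      push_cast
      rw [pow_succ]
      field_simp
      ring
  have hbound : ∀ k : ℕ, |D z - D z₀| ≤ K * (r * (1 / 2) ^ k) + 4 * τ := by
    intro k
    refine (abs_sub_le _ (D (π k)) _).trans (add_le_add ?_ ?_)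
    · refine (hLip _ hz _ (hNB k _ (hπN k))).trans ?_
      rw [one_div, inv_pow, ← div_eq_mul_inv]
      exact mul_le_mul_of_nonneg_left (hπ k) hK
    · refine (hsum k).trans ?_
      have : (0 : ℝ) ≤ (2 * k + 4) / 2 ^ k := by positivity
      nlinarith
  have hlim : Filter.Tendsto (fun k : ℕ => K * (r * (1 / 2 : ℝ) ^ k) + 4 * τ) Filter.atTop
      (nhds (K * (r * 0) + 4 * τ)) :=
    (((tendsto_pow_atTop_nhds_zero_of_lt_one (by norm_num) (by norm_num)).const_mul r).const_mul
      K).add_const _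
  simpa using ge_of_tendsto' hlim hbound

/-! ### Hoeffding's inequality for an i.i.d. sample -/

/-- The deviation `P f(z) - Pₙ f(z)` of the empirical mean of `f z` from its expectation. -/
noncomputable def empDeviation {E Ξ : Type*} [MeasurableSpace Ξ] (P : Measure Ξ) {n : ℕ}
    (f : E → Ξ → ℝ) (S : Fin n → Ξ) (z : E) : ℝ :=
  ∫ ξ, f z ξ ∂P - (1 / (n : ℝ)) * ∑ i, f z (S i)

theorem measure_pi_le_sum_sub_integral_le {Ξ : Type*} [MeasurableSpace Ξ] (P : Measure Ξ)
    [IsProbabilityMeasure P] {g : Ξ → ℝ} (hg : AEMeasurable g P) {b : ℝ} (hb0 : 0 ≤ b)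
    (hb : ∀ᵐ ξ ∂P, |g ξ| ≤ b) (n : ℕ) {a : ℝ} (ha : 0 ≤ a) :
    Measure.pi (fun _ : Fin n => P) {S | a ≤ ∑ i, (g (S i) - ∫ ξ, g ξ ∂P)} ≤
      ENNReal.ofReal (Real.exp (-a ^ 2 / (2 * (n * b ^ 2)))) := by
  have hmeas : ∀ _ : Fin n, AEMeasurable (fun ξ => g ξ - ∫ ξ, g ξ ∂P) P := fun _ => hg.sub_const _
  have hind : ProbabilityTheory.iIndepFun
      (fun (i : Fin n) (S : Fin n → Ξ) => g (S i) - ∫ ξ, g ξ ∂P) (Measure.pi fun _ => P) :=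
    ProbabilityTheory.iIndepFun_pi hmeas
  have hsub : ProbabilityTheory.HasSubgaussianMGF (fun ξ => g ξ - ∫ ξ, g ξ ∂P)
      ((‖b - (-b)‖₊ / 2) ^ 2) P :=
    ProbabilityTheory.hasSubgaussianMGF_of_mem_Icc hg
      (hb.mono fun ξ h => ⟨(abs_le.1 h).1, (abs_le.1 h).2⟩)
  have hsubi : ∀ i ∈ (Finset.univ : Finset (Fin n)), ProbabilityTheory.HasSubgaussianMGF
      (fun S : Fin n → Ξ => g (S i) - ∫ ξ, g ξ ∂P) ((‖b - (-b)‖₊ / 2) ^ 2)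
      (Measure.pi fun _ => P) := by
    intro i _
    refine ProbabilityTheory.HasSubgaussianMGF.of_map
      (X := fun ξ => g ξ - ∫ ξ, g ξ ∂P) (Y := fun S : Fin n → Ξ => S i)
      (measurable_pi_apply i).aemeasurable ?_
    have hmap : (Measure.pi fun _ : Fin n => P).map (fun S => S i) = P :=
      (measurePreserving_eval (fun _ : Fin n => P) i).map_eq
    rwa [hmap]
  have h := ProbabilityTheory.HasSubgaussianMGF.measure_sum_ge_le_of_iIndepFun hind hsubi ha
  rw [measureReal_def] at h
  rw [← ENNReal.ofReal_toReal (measure_ne_top (Measure.pi fun _ : Fin n => P) _)]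
  refine ENNReal.ofReal_le_ofReal (h.trans (le_of_eq ?_))
  have : |b + b| / 2 = b := by rw [abs_of_nonneg (by linarith)]; ring
  simp [this]

theorem measure_pi_le_abs_empDeviation_sub_le {E Ξ : Type*} [MeasurableSpace Ξ] (P : Measure Ξ)
    [IsProbabilityMeasure P] {f : E → Ξ → ℝ} {u v : E} (hu : Integrable (f u) P)
    (hv : Integrable (f v) P) {b : ℝ} (hb0 : 0 < b) (hb : ∀ᵐ ξ ∂P, |f u ξ - f v ξ| ≤ b)
    {n : ℕ} (hn : 0 < n) {t : ℝ} (ht : 0 ≤ t) :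
    Measure.pi (fun _ : Fin n => P) {S | t ≤ |empDeviation P f S u - empDeviation P f S v|} ≤
      ENNReal.ofReal (2 * Real.exp (-(n * t ^ 2 / (2 * b ^ 2)))) := by
  have hn' : (0 : ℝ) < n := Nat.cast_pos.2 hn
  have key : ∀ u v : E, Integrable (f u) P → Integrable (f v) P →
      (∀ᵐ ξ ∂P, |f u ξ - f v ξ| ≤ b) →
      Measure.pi (fun _ : Fin n => P) {S | t ≤ empDeviation P f S v - empDeviation P f S u} ≤
      ENNReal.ofReal (Real.exp (-(n * t ^ 2 / (2 * b ^ 2)))) := by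
    intro u v hu hv hb
    have h := measure_pi_le_sum_sub_integral_le P (hu.sub hv).aemeasurable hb0.le hb n
      (a := n * t) (by positivity)
    have hset : {S : Fin n → Ξ | t ≤ empDeviation P f S v - empDeviation P f S u} =
        {S | n * t ≤ ∑ i, ((f u - f v) (S i) - ∫ ξ, (f u - f v) ξ ∂P)} := by
      ext S
      simp only [Set.mem_ofPred_eq, empDeviation, Pi.sub_apply, integral_sub hu hv,
        Finset.sum_sub_distrib, Finset.sum_const, Finset.card_univ, Fintype.card_fin, nsmul_eq_mul]
      rw [← mul_le_mul_iff_right₀ hn']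
      have : (n : ℝ) * (∫ ξ, f v ξ ∂P - 1 / n * ∑ i, f v (S i) -
          (∫ ξ, f u ξ ∂P - 1 / n * ∑ i, f u (S i))) =
          ∑ i, f u (S i) - ∑ i, f v (S i) - (n * ∫ ξ, f u ξ ∂P - n * ∫ ξ, f v ξ ∂P) := by
        field_simp
        ring
      rw [this]
    rw [hset]
    refine h.trans (le_of_eq ?_)
    congr 2
    field_simp
  have hsub : {S : Fin n → Ξ | t ≤ |empDeviation P f S u - empDeviation P f S v|} ⊆
      {S | t ≤ empDeviation P f S v - empDeviation P f S u} ∪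
        {S | t ≤ empDeviation P f S u - empDeviation P f S v} := by
    intro S hS
    have hS' : t ≤ |empDeviation P f S u - empDeviation P f S v| := hS
    rcases le_abs.1 hS' with h | h
    · exact Or.inr h
    · exact Or.inl (by simpa using h)
  refine (measure_mono hsub).trans ((measure_union_le _ _).trans ?_)
  rw [two_mul, ENNReal.ofReal_add (Real.exp_pos _).le (Real.exp_pos _).le]
  exact add_le_add (key u v hu hv hb)
    (key v u hv hu (hb.mono fun ξ h => by rwa [abs_sub_comm]))

/-! ### Uniform concentration by chaining and peeling -/

theorem ae_abs_empDeviation_sub_le {E Ξ : Type*} [NormedAddCommGroup E] [MeasurableSpace Ξ]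
    (P : Measure Ξ) [IsProbabilityMeasure P] {f : E → Ξ → ℝ} {Z : Set E} {L : ℝ}
    (hint : ∀ z ∈ Z, Integrable (f z) P)
    (hlip : ∀ᵐ ξ ∂P, ∀ z ∈ Z, ∀ z' ∈ Z, |f z ξ - f z' ξ| ≤ L * ‖z - z'‖) {n : ℕ} (hn : 0 < n) :
    ∀ᵐ S ∂(Measure.pi fun _ : Fin n => P), ∀ u ∈ Z, ∀ v ∈ Z,
      |empDeviation P f S u - empDeviation P f S v| ≤ 2 * L * ‖u - v‖ := by
  have hall : ∀ᵐ S ∂(Measure.pi fun _ : Fin n => P), ∀ i,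
      ∀ z ∈ Z, ∀ z' ∈ Z, |f z (S i) - f z' (S i)| ≤ L * ‖z - z'‖ :=
    ae_all_iff.2 fun i => Measure.tendsto_eval_ae_ae (μ := fun _ : Fin n => P) (i := i) hlip
  filter_upwards [hall] with S hS u hu v hv
  have hn' : (0 : ℝ) < n := Nat.cast_pos.2 hn
  have h1 : |∫ ξ, f u ξ ∂P - ∫ ξ, f v ξ ∂P| ≤ L * ‖u - v‖ := by
    rw [← integral_sub (hint u hu) (hint v hv)]
    have := norm_integral_le_of_norm_le_const (μ := P) (f := fun ξ => f u ξ - f v ξ)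
      (hlip.mono fun ξ h => h u hu v hv)
    simpa using this
  have h2 : |(1 / (n : ℝ)) * ∑ i, f u (S i) - (1 / (n : ℝ)) * ∑ i, f v (S i)|
      ≤ L * ‖u - v‖ := by
    rw [← mul_sub, ← Finset.sum_sub_distrib, abs_mul, abs_of_pos (by positivity : 0 < 1 / (n : ℝ)),
      one_div, inv_mul_le_iff₀ hn']
    refine (Finset.abs_sum_le_sum_abs _ _).trans ?_
    refine (Finset.sum_le_sum fun i _ => hS i u hu v hv).trans (le_of_eq ?_)
    simp
  calc |empDeviation P f S u - empDeviation P f S v|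
      = |(∫ ξ, f u ξ ∂P - ∫ ξ, f v ξ ∂P) -
        ((1 / (n : ℝ)) * ∑ i, f u (S i) - (1 / (n : ℝ)) * ∑ i, f v (S i))| := by
          unfold empDeviation; congr 1; ring
    _ ≤ L * ‖u - v‖ + L * ‖u - v‖ := (abs_sub _ _).trans (add_le_add h1 h2)
    _ = 2 * L * ‖u - v‖ := by ring

theorem tsum_ofReal_mul_half_pow_succ {p : ℝ} (hp : 0 ≤ p) :
    ∑' k : ℕ, ENNReal.ofReal (p * (1 / 2) ^ (k + 1)) = ENNReal.ofReal p := by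
  have h : HasSum (fun k : ℕ => p * (1 / 2 : ℝ) ^ (k + 1)) p := by
    have := (hasSum_geometric_two.mul_left (1 / 2 : ℝ)).mul_left p
    simpa [pow_succ, mul_comm, mul_assoc, mul_left_comm] using this
  rw [← ENNReal.ofReal_tsum_of_nonneg (fun k => by positivity) h.summable, h.tsum_eq]

theorem two_pow_le_exp (a : ℕ) : (2 : ℝ) ^ a ≤ Real.exp a := by
  rw [← Real.exp_one_pow]
  exact pow_le_pow_left₀ (by norm_num) (by linarith [Real.add_one_le_exp 1]) _

/-- Union bound for one chaining level: the entropy `(2k + 5) m` of the pairs of net points is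
absorbed by the Gaussian tail. -/
theorem net_pairs_mul_tail_le {m : ℕ} (hm : 1 ≤ m) {T : ℝ} (hT : (m : ℝ) ≤ T) (k : ℕ) :
    2 ^ ((k + 2) * m) * (2 ^ ((k + 1 + 2) * m) * (2 * Real.exp (-(8 * (k + 1) ^ 2 * T)))) ≤
      Real.exp (-T) * (1 / 2) ^ (k + 1) := by
  have hm' : (1 : ℝ) ≤ m := by exact_mod_cast hm
  have h := two_pow_le_exp ((k + 2) * m + (k + 1 + 2) * m + 1 + (k + 1))
  have h2 : Real.exp (((k + 2) * m + (k + 1 + 2) * m + 1 + (k + 1) : ℕ) : ℝ) ≤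
      Real.exp (8 * (k + 1) ^ 2 * T - T) := by
    refine Real.exp_le_exp.2 ?_
    push_cast
    have hk : (0 : ℝ) ≤ k := Nat.cast_nonneg k
    have h3 : ((k : ℝ) + 1) * m ≤ (k + 1) * T := by gcongr
    have hT0 : 0 ≤ T := by linarith
    have h4 : 0 ≤ (k : ℝ) * (k + 1) * T := by positivity
    have h5 : (k : ℝ) ≤ k * m := by nlinarith
    nlinarith
  have h6 := h.trans h2
  rw [div_pow, one_pow, mul_one_div, le_div_iff₀ (by positivity)]
  have h7 : Real.exp (-T) = Real.exp (8 * (k + 1) ^ 2 * T - T) *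
      Real.exp (-(8 * (k + 1) ^ 2 * T)) := by
    rw [← Real.exp_add]; congr 1; ring
  rw [h7]
  calc _ = 2 ^ ((k + 2) * m + (k + 1 + 2) * m + 1 + (k + 1)) *
        Real.exp (-(8 * ((k : ℝ) + 1) ^ 2 * T)) := by ring
    _ ≤ _ := by gcongr

/-- Chaining bound over a ball: outside an event of probability `exp (-T)`, with `T` at least the
dimension, the deviations on a set of radius `r` are at most `32 L r √(T / n)`. The dyadic nets
make this free of logarithms of `n`. -/
theorem measure_pi_exists_deviation_ball_le {E Ξ : Type*} [NormedAddCommGroup E] [NormedSpace ℝ E]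
    [FiniteDimensional ℝ E] [MeasurableSpace Ξ] (P : Measure Ξ) [IsProbabilityMeasure P]
    {f : E → Ξ → ℝ} {Z : Set E} {z₀ : E} (hz₀ : z₀ ∈ Z) {L r T : ℝ} (hL : 0 < L) (hr : 0 < r)
    (hint : ∀ z ∈ Z, Integrable (f z) P)
    (hlip : ∀ᵐ ξ ∂P, ∀ z ∈ Z, ∀ z' ∈ Z, |f z ξ - f z' ξ| ≤ L * ‖z - z'‖) {n : ℕ} (hn : 0 < n)
    (hm : 1 ≤ Module.finrank ℝ E) (hT : (Module.finrank ℝ E : ℝ) ≤ T) :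
    Measure.pi (fun _ : Fin n => P) {S | ∃ z ∈ Z, ‖z - z₀‖ ≤ r ∧
      32 * L * r * √(T / n) < |empDeviation P f S z - empDeviation P f S z₀|} ≤
      ENNReal.ofReal (Real.exp (-T)) := by
  classical
  have hn' : (0 : ℝ) < n := Nat.cast_pos.2 hn
  have hm' : (1 : ℝ) ≤ Module.finrank ℝ E := by exact_mod_cast hm
  have hT0 : 0 < T := by linarith
  set m := Module.finrank ℝ E
  set B : Set E := {z | z ∈ Z ∧ ‖z - z₀‖ ≤ r} with hBdef
  have hz₀B : z₀ ∈ B := ⟨hz₀, by simpa using hr.le⟩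
  -- The coarsest net is replaced by `{z₀}`, the starting point of every chain.
  have hnets : ∀ k : ℕ, ∃ N : Finset E, (k = 0 → N = {z₀}) ∧ (∀ u ∈ N, u ∈ B) ∧
      (∀ z ∈ B, ∃ u ∈ N, ‖z - u‖ ≤ r / 2 ^ k) ∧ N.card ≤ 2 ^ ((k + 2) * m) := by
    intro k
    rcases Nat.eq_zero_or_pos k with rfl | hk
    · refine ⟨{z₀}, fun _ => rfl, by simpa using hz₀B, fun z hz => ⟨z₀, by simp, ?_⟩, ?_⟩
      · simpa using hz.2
      · simpa using Nat.one_le_two_pow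
    · obtain ⟨N, h1, h2, h3⟩ := exists_finset_net hr (B := B) (fun z hz => hz.2) k
      exact ⟨N, fun h => absurd h hk.ne', h1, h2, h3⟩
  choose N hN0 hNB hnet hcard using hnets
  set τ : ℝ := 8 * L * r * √(T / n) with hτ
  have hτ0 : 0 ≤ τ := by positivity
  set A : ℕ → Set (Fin n → Ξ) := fun k => {S | ∃ u ∈ N k, ∃ v ∈ N (k + 1),
    ‖u - v‖ ≤ 2 * r / 2 ^ k ∧
      τ * ((k + 1) / 2 ^ k) ≤ |empDeviation P f S u - empDeviation P f S v|} with hA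
  have hpair : ∀ k, ∀ u ∈ N k, ∀ v ∈ N (k + 1), ‖u - v‖ ≤ 2 * r / 2 ^ k →
      Measure.pi (fun _ : Fin n => P) {S | τ * ((k + 1) / 2 ^ k) ≤
        |empDeviation P f S u - empDeviation P f S v|} ≤
      ENNReal.ofReal (2 * Real.exp (-(8 * (k + 1) ^ 2 * T))) := by
    intro k u hu v hv huv
    have hb : ∀ᵐ ξ ∂P, |f u ξ - f v ξ| ≤ L * (2 * r / 2 ^ k) := by
      filter_upwards [hlip] with ξ hξ
      exact (hξ u (hNB k u hu).1 v (hNB _ v hv).1).trans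
        (mul_le_mul_of_nonneg_left huv hL.le)
    refine (measure_pi_le_abs_empDeviation_sub_le P (hint u (hNB k u hu).1)
      (hint v (hNB _ v hv).1) (b := L * (2 * r / 2 ^ k)) (by positivity) hb hn
      (by positivity)).trans (le_of_eq ?_)
    congr 4
    rw [hτ, mul_pow, mul_pow (8 * L * r), Real.sq_sqrt (by positivity)]
    field_simp
    ring
  have hAk : ∀ k, Measure.pi (fun _ : Fin n => P) (A k) ≤
      ENNReal.ofReal (Real.exp (-T) * (1 / 2) ^ (k + 1)) := by
    intro k
    set p : ENNReal := ENNReal.ofReal (2 * Real.exp (-(8 * (k + 1) ^ 2 * T)))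
    have hsub : A k ⊆ ⋃ u ∈ N k, ⋃ v ∈ (N (k + 1)).filter (fun v => ‖u - v‖ ≤ 2 * r / 2 ^ k),
        {S | τ * ((k + 1) / 2 ^ k) ≤ |empDeviation P f S u - empDeviation P f S v|} := by
      rintro S ⟨u, hu, v, hv, huv, h⟩
      simp only [Set.mem_iUnion]
      exact ⟨u, hu, v, Finset.mem_filter.2 ⟨hv, huv⟩, h⟩
    have hcount : Measure.pi (fun _ : Fin n => P) (A k) ≤
        (N k).card * ((N (k + 1)).card * p) := by
      refine (measure_mono hsub).trans ((measure_biUnion_finset_le _ _).trans ?_)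
      rw [← nsmul_eq_mul]
      refine Finset.sum_le_card_nsmul _ _ _ fun u hu => (measure_biUnion_finset_le _ _).trans ?_
      refine (Finset.sum_le_card_nsmul _ _ p fun v hv => ?_).trans ?_
      · exact hpair k u hu v (Finset.mem_filter.1 hv).1 (Finset.mem_filter.1 hv).2
      · rw [nsmul_eq_mul]
        gcongr
        exact Finset.filter_subset _ _
    refine hcount.trans ?_
    refine le_trans ?_ (ENNReal.ofReal_le_ofReal (net_pairs_mul_tail_le hm hT k))
    rw [ENNReal.ofReal_mul (by positivity), ENNReal.ofReal_mul (by positivity)]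
    have hc : ∀ k, ((N k).card : ENNReal) ≤ ENNReal.ofReal (2 ^ ((k + 2) * m)) := by
      intro k
      rw [← ENNReal.ofReal_natCast]
      exact ENNReal.ofReal_le_ofReal (by exact_mod_cast hcard k)
    exact mul_le_mul' (hc k) (mul_le_mul' (hc (k + 1)) le_rfl)
  have hunion : Measure.pi (fun _ : Fin n => P) (⋃ k, A k) ≤ ENNReal.ofReal (Real.exp (-T)) :=
    (measure_iUnion_le _).trans ((ENNReal.tsum_le_tsum hAk).trans
      (tsum_ofReal_mul_half_pow_succ (Real.exp_pos _).le).le)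
  refine (measure_mono_ae ?_).trans hunion
  filter_upwards [ae_abs_empDeviation_sub_le P hint hlip hn] with S hS hbad
  by_contra hgood
  obtain ⟨z, hzZ, hzr, hz⟩ := hbad
  have hgood' : ∀ k, S ∉ A k := fun k hk => hgood (Set.mem_iUnion.2 ⟨k, hk⟩)
  have := abs_sub_le_of_dyadic_increments hr.le hτ0 (empDeviation P f S) N (hN0 0 rfl) hNB hnet
    (by positivity) (fun u hu v hv => hS u hu.1 v hv.1)
    (fun k u hu v hv huv => by
      by_contra! h
      exact hgood' k ⟨u, hu, v, hv, huv, h.le⟩) (z := z) ⟨hzZ, hzr⟩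
  rw [hτ] at this
  linarith

/-- Localised deviation bound: with `s² = (dim + log (1 / δ)) / n`, with probability at least
`1 - δ` the deviations are at most `ε ‖z - z₀‖² + C s²` simultaneously for all `z`. The balls of
radius `4 ^ j s` are treated with tail parameter `4 ^ j n s²`: the excess over `n s²` pays for the
union over `j`, while the resulting bound `32 L 8 ^ j s²` is still of lower order than the squared
radius `16 ^ j s²`. -/
theorem measure_pi_exists_deviation_le {E Ξ : Type*} [NormedAddCommGroup E] [NormedSpace ℝ E]
    [FiniteDimensional ℝ E] [MeasurableSpace Ξ] (P : Measure Ξ) [IsProbabilityMeasure P]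
    {f : E → Ξ → ℝ} {Z : Set E} {z₀ : E} (hz₀ : z₀ ∈ Z) {L ε : ℝ} (hL : 0 < L) (hε : 0 < ε)
    (hint : ∀ z ∈ Z, Integrable (f z) P)
    (hlip : ∀ᵐ ξ ∂P, ∀ z ∈ Z, ∀ z' ∈ Z, |f z ξ - f z' ξ| ≤ L * ‖z - z'‖) {n : ℕ} (hn : 0 < n)
    (hm : 1 ≤ Module.finrank ℝ E) {δ : ℝ} (hδ : 0 < δ) (hδ1 : δ < 1) :
    Measure.pi (fun _ : Fin n => P) {S | ∃ z ∈ Z, 16 * ε * ‖z - z₀‖ ^ 2 +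
      (ε + (32 * L) ^ 4 / ε ^ 3) * ((Module.finrank ℝ E + Real.log (1 / δ)) / n) <
        |empDeviation P f S z - empDeviation P f S z₀|} ≤ ENNReal.ofReal δ := by
  have hn' : (0 : ℝ) < n := Nat.cast_pos.2 hn
  have hm' : (1 : ℝ) ≤ Module.finrank ℝ E := by exact_mod_cast hm
  have hlog : 0 ≤ Real.log (1 / δ) := Real.log_nonneg (by rw [le_div_iff₀ hδ]; linarith)
  set H : ℝ := Module.finrank ℝ E + Real.log (1 / δ) with hH
  have hH1 : 1 ≤ H := by linarith
  set s : ℝ := √(H / n) with hs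
  have hs2 : s ^ 2 = H / n := Real.sq_sqrt (by positivity)
  have hs0 : 0 < s := Real.sqrt_pos.2 (by positivity)
  set A : ℕ → Set (Fin n → Ξ) := fun j => {S | ∃ z ∈ Z, ‖z - z₀‖ ≤ 4 ^ j * s ∧
      32 * L * (4 ^ j * s) * √(4 ^ j * H / n) <
        |empDeviation P f S z - empDeviation P f S z₀|} with hA
  have hAj : ∀ j, Measure.pi (fun _ : Fin n => P) (A j) ≤
      ENNReal.ofReal (δ * (1 / 2) ^ (j + 1)) := by
    intro j
    have h4 : (1 : ℝ) + j * 3 ≤ 4 ^ j := by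
      have := one_add_mul_le_pow (a := (3 : ℝ)) (by norm_num) j
      norm_num at this ⊢
      exact this
    have hj : (0 : ℝ) ≤ j := Nat.cast_nonneg j
    refine (measure_pi_exists_deviation_ball_le P hz₀ hL (by positivity) hint hlip hn hm
      (T := 4 ^ j * H) (by nlinarith)).trans (ENNReal.ofReal_le_ofReal ?_)
    have h2 := two_pow_le_exp (j + 1)
    have hδexp : δ = Real.exp (-Real.log (1 / δ)) := by
      rw [one_div, Real.log_inv, neg_neg, Real.exp_log hδ]
    rw [div_pow, one_pow, mul_one_div, le_div_iff₀ (by positivity)]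
    calc Real.exp (-(4 ^ j * H)) * 2 ^ (j + 1)
        ≤ Real.exp (-(4 ^ j * H)) * Real.exp ((j + 1 : ℕ) : ℝ) := by gcongr
      _ = Real.exp (-(4 ^ j * H) + (j + 1)) := by rw [← Real.exp_add]; push_cast; rfl
      _ ≤ Real.exp (-Real.log (1 / δ)) := Real.exp_le_exp.2 (by nlinarith)
      _ = δ := hδexp.symm
  have hunion : Measure.pi (fun _ : Fin n => P) (⋃ j, A j) ≤ ENNReal.ofReal δ :=
    (measure_iUnion_le _).trans ((ENNReal.tsum_le_tsum hAj).trans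
      (tsum_ofReal_mul_half_pow_succ hδ.le).le)
  refine (measure_mono ?_).trans hunion
  rintro S ⟨z, hz, hbad⟩
  -- `j` is the first shell that contains `z`.
  have hex : ∃ j : ℕ, ‖z - z₀‖ ≤ 4 ^ j * s := by
    obtain ⟨j, hj⟩ := pow_unbounded_of_one_lt (‖z - z₀‖ / s) (by norm_num : (1 : ℝ) < 4)
    exact ⟨j, ((div_lt_iff₀ hs0).1 hj).le⟩
  classical
  set j := Nat.find hex with hjdef
  refine Set.mem_iUnion.2 ⟨j, z, hz, Nat.find_spec hex, lt_of_le_of_lt ?_ hbad⟩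
  set q : ℝ := 2 ^ j with hq
  have hq0 : 0 < q := by positivity
  have h4q : (4 : ℝ) ^ j = q ^ 2 := by rw [hq, ← pow_mul, mul_comm, pow_mul]; norm_num
  have hsqrt : √(4 ^ j * H / n) = q * s := by
    rw [h4q, mul_div_assoc, Real.sqrt_mul (by positivity), Real.sqrt_sq hq0.le]
  have hyoung : 32 * L * q ^ 3 ≤ ε * q ^ 4 + (32 * L) ^ 4 / ε ^ 3 := by
    rcases le_total (32 * L) (ε * q) with h | h
    · have h1 : 32 * L * q ^ 3 ≤ ε * q * q ^ 3 := by gcongr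
      have h2 : 0 ≤ (32 * L) ^ 4 / ε ^ 3 := by positivity
      nlinarith
    · have h1 : 32 * L * q ^ 3 ≤ (32 * L) ^ 4 / ε ^ 3 := by
        rw [le_div_iff₀ (by positivity)]
        calc 32 * L * q ^ 3 * ε ^ 3 = 32 * L * (ε * q) ^ 3 := by ring
          _ ≤ 32 * L * (32 * L) ^ 3 := by gcongr
          _ = (32 * L) ^ 4 := by ring
      have h2 : 0 ≤ ε * q ^ 4 := by positivity
      linarith
  have hradius : q ^ 4 * s ^ 2 ≤ 16 * ‖z - z₀‖ ^ 2 + s ^ 2 := by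
    rcases Nat.eq_zero_or_pos j with h0 | hpos
    · rw [hq, h0]
      nlinarith [sq_nonneg ‖z - z₀‖]
    · have hlt := Nat.find_min hex (m := j - 1) (by omega)
      have h4 : (4 : ℝ) * 4 ^ (j - 1) = q ^ 2 := by
        rw [← h4q, ← pow_succ', Nat.sub_add_cancel hpos]
      have h5 : q ^ 2 * s ≤ 4 * ‖z - z₀‖ := by
        rw [← h4]; linarith
      have h6 : (q ^ 2 * s) ^ 2 ≤ (4 * ‖z - z₀‖) ^ 2 := by gcongr
      nlinarith [sq_nonneg s]
  rw [hsqrt, h4q, ← hs2]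
  calc 32 * L * (q ^ 2 * s) * (q * s) = 32 * L * q ^ 3 * s ^ 2 := by ring
    _ ≤ (ε * q ^ 4 + (32 * L) ^ 4 / ε ^ 3) * s ^ 2 := by gcongr
    _ = ε * (q ^ 4 * s ^ 2) + (32 * L) ^ 4 / ε ^ 3 * s ^ 2 := by ring
    _ ≤ ε * (16 * ‖z - z₀‖ ^ 2 + s ^ 2) + (32 * L) ^ 4 / ε ^ 3 * s ^ 2 := by gcongr
    _ = 16 * ε * ‖z - z₀‖ ^ 2 + (ε + (32 * L) ^ 4 / ε ^ 3) * s ^ 2 := by ring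

/-! ### Quadratic growth of the strong excess risk -/

theorem StrongConvexOn.add_sq_le_of_isMinOn {E : Type*} [NormedAddCommGroup E] [NormedSpace ℝ E]
    {s : Set E} {σ : ℝ} {g : E → ℝ} (hg : StrongConvexOn s σ g) {x₀ x : E} (hx₀ : x₀ ∈ s)
    (hmin : IsMinOn g s x₀) (hx : x ∈ s) : g x₀ + σ / 4 * ‖x - x₀‖ ^ 2 ≤ g x := by
  -- The midpoint already gives growth with constant `σ / 4`, which suffices up to constants.
  have h := hg.2 hx hx₀ (by norm_num : (0 : ℝ) ≤ 1 / 2) (by norm_num : (0 : ℝ) ≤ 1 / 2)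
    (by norm_num)
  have h' := isMinOn_iff.1 hmin _
    (hg.1 hx hx₀ (by norm_num : (0 : ℝ) ≤ 1 / 2) (by norm_num : (0 : ℝ) ≤ 1 / 2)
      (by norm_num))
  simp only [smul_eq_mul] at h
  linarith

theorem StrongConcaveOn.add_sq_le_of_isMaxOn {E : Type*} [NormedAddCommGroup E] [NormedSpace ℝ E]
    {s : Set E} {σ : ℝ} {g : E → ℝ} (hg : StrongConcaveOn s σ g) {x₀ x : E} (hx₀ : x₀ ∈ s)
    (hmax : IsMaxOn g s x₀) (hx : x ∈ s) : g x + σ / 4 * ‖x - x₀‖ ^ 2 ≤ g x₀ := by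
  have h := StrongConvexOn.add_sq_le_of_isMinOn (UniformConcaveOn.neg hg) hx₀ hmax.neg hx
  simp only [Pi.neg_apply] at h
  linarith

/-- The strong excess risk dominates the squared distances of all four points involved to a
saddle point `(x₀, y₀)`: by strong concavity `G x (ys x)` exceeds `G x y₀`, which by strong convexity
exceeds `G x₀ y₀`, and symmetrically `G (xs y) y` lies below `G x₀ y₀`. -/
theorem mul_sq_norm_le_strongExcessRisk {EX EY : Type*} [NormedAddCommGroup EX] [NormedSpace ℝ EX]
    [NormedAddCommGroup EY] [NormedSpace ℝ EY] {X : Set EX} {Y : Set EY}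
    {G : EX → EY → ℝ} {σx σy σ : ℝ} (hx : σ ≤ σx)
    (hy : σ ≤ σy) (hG : StronglyConvexConcave X Y σx σy G) {xs : EY → EX} {ys : EX → EY}
    (hxs : IsArgminMap X Y G xs) (hys : IsArgmaxMap X Y G ys) {x₀ x : EX} {y₀ y : EY}
    (h₀ : IsSaddleSolution X Y G x₀ y₀) (hxX : x ∈ X) (hyY : y ∈ Y) :
    σ / 4 * ((‖x - x₀‖ ^ 2 + ‖ys x - y₀‖ ^ 2) + (‖xs y - x₀‖ ^ 2 + ‖y - y₀‖ ^ 2)) ≤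
      strongExcessRisk G xs ys x y := by
  obtain ⟨hx₀, hy₀, hsad⟩ := h₀
  have h1 := (hG.2 x hxX).add_sq_le_of_isMaxOn (hys x hxX).1 (hys x hxX).2 hy₀
  have h2 := (hG.1 y₀ hy₀).add_sq_le_of_isMinOn hx₀
    (isMinOn_iff.2 fun u hu => hsad u hu y₀ hy₀) hxX
  have h3 := (hG.1 y hyY).add_sq_le_of_isMinOn (hxs y hyY).1 (hxs y hyY).2 hx₀
  have h4 := (hG.2 x₀ hx₀).add_sq_le_of_isMaxOn hy₀
    (isMaxOn_iff.2 fun v hv => hsad x₀ hx₀ v hv) hyY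
  rw [norm_sub_rev y₀] at h1
  rw [norm_sub_rev x₀] at h3
  unfold strongExcessRisk
  have e1 : σ / 4 * ‖ys x - y₀‖ ^ 2 ≤ σy / 4 * ‖ys x - y₀‖ ^ 2 := by gcongr
  have e2 : σ / 4 * ‖x - x₀‖ ^ 2 ≤ σx / 4 * ‖x - x₀‖ ^ 2 := by gcongr
  have e3 : σ / 4 * ‖xs y - x₀‖ ^ 2 ≤ σx / 4 * ‖xs y - x₀‖ ^ 2 := by gcongr
  have e4 : σ / 4 * ‖y - y₀‖ ^ 2 ≤ σy / 4 * ‖y - y₀‖ ^ 2 := by gcongr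
  linarith

/-! ### The population objective -/

theorem separatelyLipschitz_popObjective {EX EY Ξ : Type*} [NormedAddCommGroup EX]
    [NormedAddCommGroup EY] [MeasurableSpace Ξ] {X : Set EX} {Y : Set EY} {P : Measure Ξ}
    [IsProbabilityMeasure P] {F : EX → EY → Ξ → ℝ} {Lx Ly : ℝ}
    (hint : ∀ x ∈ X, ∀ y ∈ Y, Integrable (F x y) P)
    (h : ∀ᵐ ξ ∂P, SeparatelyLipschitz X Y Lx Ly (fun x y => F x y ξ)) :
    SeparatelyLipschitz X Y Lx Ly (popObjective P F) := by
  refine ⟨fun x hx x' hx' y hy => ?_, fun x hx y hy y' hy' => ?_⟩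
  · simp only [popObjective]
    rw [← integral_sub (hint x hx y hy) (hint x' hx' y hy)]
    have := norm_integral_le_of_norm_le_const (μ := P) (f := fun ξ => F x y ξ - F x' y ξ)
      (h.mono fun ξ hξ => hξ.1 x hx x' hx' y hy)
    simpa using this
  · simp only [popObjective]
    rw [← integral_sub (hint x hx y hy) (hint x hx y' hy')]
    have := norm_integral_le_of_norm_le_const (μ := P) (f := fun ξ => F x y ξ - F x y' ξ)
      (h.mono fun ξ hξ => hξ.2 x hx y hy y' hy')
    simpa using this

theorem stronglyConvexConcave_popObjective {EX EY Ξ : Type*} [NormedAddCommGroup EX]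
    [NormedSpace ℝ EX] [NormedAddCommGroup EY] [NormedSpace ℝ EY] [MeasurableSpace Ξ]
    {X : Set EX} {Y : Set EY}
    {P : Measure Ξ} [IsProbabilityMeasure P]
    (hX : Convex ℝ X) (hY : Convex ℝ Y) {F : EX → EY → Ξ → ℝ} {σx σy : ℝ}
    (hint : ∀ x ∈ X, ∀ y ∈ Y, Integrable (F x y) P)
    (h : ∀ᵐ ξ ∂P, StronglyConvexConcave X Y σx σy (fun x y => F x y ξ)) :
    StronglyConvexConcave X Y σx σy (popObjective P F) := by
  have hc : ∀ c : ℝ, ∫ _, c ∂P = c := fun c => by simp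
  refine ⟨fun y hy => ⟨hX, fun x hx x' hx' a b ha hb hab => ?_⟩,
    fun x hx => ⟨hY, fun y hy y' hy' a b ha hb hab => ?_⟩⟩
  · have hi := (hint x hx y hy).const_mul a
    have hi' := (hint x' hx' y hy).const_mul b
    simp only [popObjective, smul_eq_mul]
    rw [← integral_const_mul, ← integral_const_mul, ← integral_add hi hi',
      ← hc (a * b * (σx / 2 * ‖x - x'‖ ^ 2)),
      ← integral_sub (by exact hi.add hi') (integrable_const _)]
    refine integral_mono_ae (hint _ (hX hx hx' ha hb hab) y hy)
      ((hi.add hi').sub (integrable_const _)) ?_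
    filter_upwards [h] with ξ hξ
    exact (hξ.1 y hy).2 hx hx' ha hb hab
  · have hi := (hint x hx y hy).const_mul a
    have hi' := (hint x hx y' hy').const_mul b
    simp only [popObjective, smul_eq_mul]
    rw [← integral_const_mul, ← integral_const_mul, ← integral_add hi hi',
      ← hc (a * b * (σy / 2 * ‖y - y'‖ ^ 2)),
      ← integral_add (by exact hi.add hi') (integrable_const _)]
    refine integral_mono_ae ((hi.add hi').add (integrable_const _))
      (hint x hx _ (hY hy hy' ha hb hab)) ?_
    filter_upwards [h] with ξ hξ
    exact (hξ.2 x hx).2 hy hy' ha hb hab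

/-- Sion's minimax theorem for strongly convex-concave Lipschitz objectives. -/
theorem exists_isSaddleSolution {EX EY : Type*} [NormedAddCommGroup EX] [NormedSpace ℝ EX]
    [NormedAddCommGroup EY] [NormedSpace ℝ EY] {X : Set EX} {Y : Set EY}
    {G : EX → EY → ℝ} {σx σy Lx Ly : ℝ} (hσx : 0 ≤ σx) (hσy : 0 ≤ σy)
    (hLx : 0 ≤ Lx) (hLy : 0 ≤ Ly) (hX : Convex ℝ X) (kX : IsCompact X) (neX : X.Nonempty)
    (hY : Convex ℝ Y) (kY : IsCompact Y) (neY : Y.Nonempty)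
    (hG : StronglyConvexConcave X Y σx σy G) (hlip : SeparatelyLipschitz X Y Lx Ly G) :
    ∃ x₀ y₀, IsSaddleSolution X Y G x₀ y₀ := by
  have hcx : ∀ y ∈ Y, ContinuousOn (fun x => G x y) X := fun y hy =>
    (LipschitzOnWith.of_dist_le_mul (K := ⟨Lx, hLx⟩) fun x hx x' hx' => by
      rw [Real.dist_eq, dist_eq_norm]
      exact hlip.1 x hx x' hx' y hy).continuousOn
  have hcy : ∀ x ∈ X, ContinuousOn (fun y => G x y) Y := fun x hx =>
    (LipschitzOnWith.of_dist_le_mul (K := ⟨Ly, hLy⟩) fun y hy y' hy' => by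
      rw [Real.dist_eq, dist_eq_norm]
      exact hlip.2 x hx y hy y' hy').continuousOn
  obtain ⟨x₀, hx₀, y₀, hy₀, h⟩ := Sion.exists_isSaddlePointOn neX hX kX
    (fun y hy => (hcx y hy).lowerSemicontinuousOn)
    (fun y hy => (UniformConvexOn.convexOn (hG.1 y hy)
      (fun r => by simp only [Pi.zero_apply]; positivity)).quasiconvexOn)
    hY neY kY
    (fun x hx => (hcy x hx).upperSemicontinuousOn)
    (fun x hx => (UniformConcaveOn.concaveOn (hG.2 x hx)
      (fun r => by simp only [Pi.zero_apply]; positivity)).quasiconcaveOn)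
  exact ⟨x₀, y₀, hx₀, hy₀, h⟩

theorem SeparatelyLipschitz.abs_sub_le {EX EY : Type*} [NormedAddCommGroup EX]
    [NormedAddCommGroup EY] {X : Set EX} {Y : Set EY} {Lx Ly : ℝ} (hLx : 0 ≤ Lx) (hLy : 0 ≤ Ly)
    {G : EX → EY → ℝ} (h : SeparatelyLipschitz X Y Lx Ly G) {z z' : EX × EY} (hz : z ∈ X ×ˢ Y)
    (hz' : z' ∈ X ×ˢ Y) : |G z.1 z.2 - G z'.1 z'.2| ≤ (Lx + Ly) * ‖z - z'‖ := by
  have h1 := h.1 z.1 hz.1 z'.1 hz'.1 z.2 hz.2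
  have h2 := h.2 z'.1 hz'.1 z.2 hz.2 z'.2 hz'.2
  have h3 : ‖z.1 - z'.1‖ ≤ ‖z - z'‖ := norm_fst_le (z - z')
  have h4 : ‖z.2 - z'.2‖ ≤ ‖z - z'‖ := norm_snd_le (z - z')
  refine (_root_.abs_sub_le _ (G z'.1 z.2) _).trans ?_
  nlinarith [mul_le_mul_of_nonneg_left h3 hLx, mul_le_mul_of_nonneg_left h4 hLy]

theorem Prod.sq_norm_le_add {EX EY : Type*} [NormedAddCommGroup EX] [NormedAddCommGroup EY]
    (z : EX × EY) : ‖z‖ ^ 2 ≤ ‖z.1‖ ^ 2 + ‖z.2‖ ^ 2 := by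
  rw [Prod.norm_def]
  rcases max_cases ‖z.1‖ ‖z.2‖ with ⟨h, _⟩ | ⟨h, _⟩ <;> rw [h]
  · linarith [sq_nonneg ‖z.2‖]
  · linarith [sq_nonneg ‖z.1‖]

/-! ### Strong excess risk of empirical saddle points -/

/-- The empirical saddle inequality `Pₙ F(x, ys x) ≤ Pₙ F(xs y, y)` bounds the strong excess risk
by deviations of the empirical process between two points, hence by those from any `z₀`. -/
theorem strongExcessRisk_le_empDeviation {EX EY Ξ : Type*} [MeasurableSpace Ξ] (P : Measure Ξ)
    {F : EX → EY → Ξ → ℝ} {X : Set EX} {Y : Set EY} {xs : EY → EX} {ys : EX → EY}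
    (hxs : ∀ y ∈ Y, xs y ∈ X) (hys : ∀ x ∈ X, ys x ∈ Y) {n : ℕ} {S : Fin n → Ξ} {x : EX} {y : EY}
    (h : IsSaddleSolution X Y (empObjective F S) x y) (z₀ : EX × EY) :
    strongExcessRisk (popObjective P F) xs ys x y ≤
      |empDeviation P (fun z : EX × EY => F z.1 z.2) S (x, ys x) -
          empDeviation P (fun z : EX × EY => F z.1 z.2) S z₀| +
        |empDeviation P (fun z : EX × EY => F z.1 z.2) S (xs y, y) -
          empDeviation P (fun z : EX × EY => F z.1 z.2) S z₀| := by
  obtain ⟨hx, hy, hsad⟩ := h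
  have h1 := hsad (xs y) (hxs y hy) (ys x) (hys x hx)
  have h2 : strongExcessRisk (popObjective P F) xs ys x y ≤
      empDeviation P (fun z : EX × EY => F z.1 z.2) S (x, ys x) -
        empDeviation P (fun z : EX × EY => F z.1 z.2) S (xs y, y) := by
    simp only [empObjective] at h1
    simp only [strongExcessRisk, popObjective, empDeviation]
    linarith
  set D := empDeviation P (fun z : EX × EY => F z.1 z.2) S
  have h3 := le_abs_self (D (x, ys x) - D z₀)
  have h4 := neg_abs_le (D (xs y, y) - D z₀)
  linarith

theorem theorem1 (Lx Ly Lxy σx σy : ℝ) (hLx : 0 ≤ Lx) (hLy : 0 ≤ Ly) (hLxy : 0 ≤ Lxy)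
    (hσx : 0 < σx) (hσy : 0 < σy) (hmin : Lxy ≤ min σx σy) :
    ∃ c : ℝ, ∀ (d : ℕ)
      (EX : Type*) [NormedAddCommGroup EX] [NormedSpace ℝ EX] [FiniteDimensional ℝ EX]
      (EY : Type*) [NormedAddCommGroup EY] [NormedSpace ℝ EY] [FiniteDimensional ℝ EY]
      (_ : Module.finrank ℝ EX = d) (_ : Module.finrank ℝ EY = d)
      (X : Set EX) (_ : Convex ℝ X) (_ : IsCompact X)
      (Y : Set EY) (_ : Convex ℝ Y) (_ : IsCompact Y)
      (Ξ : Type*) [MeasurableSpace Ξ] (P : Measure Ξ) [IsProbabilityMeasure P]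
      (F : EX → EY → Ξ → ℝ)
      (_ : ∀ x ∈ X, ∀ y ∈ Y, Integrable (F x y) P)
      (_ : ∀ᵐ ξ ∂P, StronglyConvexConcave X Y σx σy (fun x y => F x y ξ))
      (_ : ∀ᵐ ξ ∂P, SeparatelyLipschitz X Y Lx Ly (fun x y => F x y ξ))
      (_ : ∀ᵐ ξ ∂P, LipschitzCrossGradient X Y Lxy (fun x y => F x y ξ))
      (xs : EY → EX) (_ : IsArgminMap X Y (popObjective P F) xs)
      (ys : EX → EY) (_ : IsArgmaxMap X Y (popObjective P F) ys)
      (n : ℕ) (_ : 0 < n) (δ : ℝ) (_ : 0 < δ) (_ : δ < 1),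
      Measure.pi (fun _ : Fin n => P)
        {S | ∃ xh yh, IsSaddleSolution X Y (empObjective F S) xh yh ∧
          c * ((d + Real.log (1 / δ)) / n)
            < strongExcessRisk (popObjective P F) xs ys xh yh} ≤ ENNReal.ofReal δ := by
  set σ : ℝ := min σx σy with hσdef
  have hσ : 0 < σ := lt_min hσx hσy
  set L : ℝ := Lx + Ly + 1 with hLdef
  have hL : 0 < L := by positivity
  -- With this `ε`, the quadratic terms `16 ε ‖z - z₀‖²` are absorbed by half of the risk.
  set ε : ℝ := σ / 128 with hεdef
  have hε : 0 < ε := by positivity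
  set C : ℝ := ε + (32 * L) ^ 4 / ε ^ 3 with hCdef
  have hC : 0 < C := by positivity
  refine ⟨8 * C, ?_⟩
  intro d EX _ _ _ EY _ _ _ hdX hdY X hX kX Y hY kY Ξ _ P _ F hint hsc hlip _ xs hxs ys hys
    n hn δ hδ hδ1
  have hn' : (0 : ℝ) < n := Nat.cast_pos.2 hn
  have hlog : 0 ≤ Real.log (1 / δ) := Real.log_nonneg (by rw [le_div_iff₀ hδ]; linarith)
  have hthr : 0 ≤ (d + Real.log (1 / δ)) / n := by positivity
  have hempty : ∀ A : Set (Fin n → Ξ), A = ∅ →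
      Measure.pi (fun _ : Fin n => P) A ≤ ENNReal.ofReal δ := by
    rintro _ rfl
    simp
  by_cases hne : X.Nonempty ∧ Y.Nonempty
  swap
  · refine hempty _ (Set.eq_empty_of_forall_notMem ?_)
    rintro S ⟨x, y, h, -⟩
    exact hne ⟨⟨x, h.1⟩, ⟨y, h.2.1⟩⟩
  rcases Nat.eq_zero_or_pos d with hd | hd
  -- In dimension zero the risk vanishes, whereas the entropy bound needs positive dimension.
  · have : Subsingleton EX := Module.finrank_zero_iff.1 (hdX.trans hd)
    have : Subsingleton EY := Module.finrank_zero_iff.1 (hdY.trans hd)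
    refine hempty _ (Set.eq_empty_of_forall_notMem ?_)
    rintro S ⟨x, y, -, h⟩
    rw [strongExcessRisk, Subsingleton.elim (ys x) y, Subsingleton.elim (xs y) x, sub_self] at h
    exact absurd h (not_lt.2 (by positivity))
  have hpop := stronglyConvexConcave_popObjective hX hY hint hsc
  obtain ⟨x₀, y₀, h₀⟩ := exists_isSaddleSolution hσx.le hσy.le hLx hLy hX kX hne.1 hY kY hne.2
    hpop (separatelyLipschitz_popObjective hint hlip)
  have hrank : Module.finrank ℝ (EX × EY) = 2 * d := by
    rw [Module.finrank_prod, hdX, hdY, two_mul]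
  have hz₀ : (x₀, y₀) ∈ X ×ˢ Y := ⟨h₀.1, h₀.2.1⟩
  have hlip' : ∀ᵐ ξ ∂P, ∀ z ∈ X ×ˢ Y, ∀ z' ∈ X ×ˢ Y,
      |F z.1 z.2 ξ - F z'.1 z'.2 ξ| ≤ L * ‖z - z'‖ := by
    filter_upwards [hlip] with ξ hξ z hz z' hz'
    refine (SeparatelyLipschitz.abs_sub_le hLx hLy hξ hz hz').trans ?_
    gcongr
    linarith
  refine (measure_mono ?_).trans (measure_pi_exists_deviation_le P
    (f := fun z : EX × EY => F z.1 z.2) hz₀ hL hε (fun z hz => hint z.1 hz.1 z.2 hz.2) hlip' hn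
    (by omega) hδ hδ1)
  rintro S ⟨x, y, hemp, hbad⟩
  by_contra hgood
  have hdev : ∀ z ∈ X ×ˢ Y, |empDeviation P (fun z : EX × EY => F z.1 z.2) S z -
      empDeviation P (fun z : EX × EY => F z.1 z.2) S (x₀, y₀)| ≤
      16 * ε * ‖z - (x₀, y₀)‖ ^ 2 + C * (((2 * d : ℕ) + Real.log (1 / δ)) / n) := by
    intro z hz
    rw [← hrank]
    by_contra! h
    exact hgood ⟨z, hz, h⟩
  have hgap := strongExcessRisk_le_empDeviation P (fun y hy => (hxs y hy).1)
    (fun x hx => (hys x hx).1) hemp (x₀, y₀)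
  have hgrow := mul_sq_norm_le_strongExcessRisk (min_le_left σx σy) (min_le_right σx σy) hpop
    hxs hys h₀ hemp.1 hemp.2.1
  have h1 := hdev (x, ys x) ⟨hemp.1, (hys x hemp.1).1⟩
  have h2 := hdev (xs y, y) ⟨(hxs y hemp.2.1).1, hemp.2.1⟩
  have n1 := Prod.sq_norm_le_add ((x, ys x) - (x₀, y₀))
  have n2 := Prod.sq_norm_le_add ((xs y, y) - (x₀, y₀))
  simp only [Prod.fst_sub, Prod.snd_sub] at n1 n2
  have m1 := mul_le_mul_of_nonneg_left n1 (by positivity : 0 ≤ 16 * ε)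
  have m2 := mul_le_mul_of_nonneg_left n2 (by positivity : 0 ≤ 16 * ε)
  have hrate : C * (((2 * d : ℕ) + Real.log (1 / δ)) / n) ≤
      2 * (C * ((d + Real.log (1 / δ)) / n)) := by
    have h : ((2 * d : ℕ) + Real.log (1 / δ)) / n ≤ 2 * ((d + Real.log (1 / δ)) / n) := by
      rw [← mul_div_assoc]
      push_cast
      gcongr
      linarith
    linarith [mul_le_mul_of_nonneg_left h hC.le]
  have h16 : 16 * ε = σ / 8 := by rw [hεdef]; ring
  rw [h16] at h1 h2 m1 m2
  rw [← hσdef] at hgrow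
  linarith
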